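/- For an index $\mathbf k=(k_1,\dots,k_r)\in(\mathbb Z_{\ge1})^r$, a natural number $n\ge1$ and a complex number $q$ with $q^m\ne1$ for $0<m<n$, let $$z_n(\mathbf k;q)=\sum_{n>m_1>\cdots>m_r>0}\ \prod_{a=1}^r\frac{q^{(k_a-1)m_a}}{[m_a]_q^{k_a}},\qquad [m]_q=\frac{1-q^m}{1-q}.$$ For integers $k\ge r\ge1$ let $I(k,r)$ be the set of indices $\mathbf k=(k_1,\dots,k_r)\in(\mathbb Z_{\ge1})^r$ of depth $r$ and weight $k_1+\cdots+k_r=k$. Then for every $\mathbf k\in I(k,r)$ the limit $$\xi(\mathbf k)=\lim_{n\to\infty}z_n(\mathbf k;e^{2\pi i/n})$$ exists in $\mathbb C$, and $$\sum_{\mathbf k\in I(k,r)}\xi(\mathbf k)=-\frac{(-2\pi i)^k}{(k+1)!}\sum_{j=1}^r\binom{k+1}{j}B_{k+1-j},$$ where $B_m$ is the $m$-th Bernoulli number, with the convention $B_1=-\frac12$. -/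

import Mathlib

/-! Finite multiple harmonic `q`-series, and their limits at `q = exp (2 π i / n)`. -/

namespace FiniteMHS

/-- The `q`-integer `[m]_q = (1 - q ^ m) / (1 - q)`. -/
noncomputable def qInt (q : ℂ) (m : ℕ) : ℂ := (1 - q ^ m) / (1 - q)

open Classical in
/-- The summation range `n > m_1 > ... > m_r > 0`. -/
noncomputable def decTuples (n r : ℕ) : Finset (Fin r → ℕ) :=
  (Fintype.piFinset fun _ : Fin r => Finset.Ioo 0 n).filter fun m => StrictAnti m

/-- The finite multiple harmonic `q`-series `z_n(k_1, ..., k_r; q)` of an index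
`K = (k_1, ..., k_r)` with positive entries. -/
noncomputable def z (n : ℕ) {r : ℕ} (K : Fin r → ℕ) (q : ℂ) : ℂ :=
  ∑ m ∈ decTuples n r, ∏ i, q ^ ((K i - 1) * m i) / qInt q (m i) ^ K i

/-- The sequence `n ↦ z_n(K; exp (2 π i / n))`. -/
noncomputable def zSeq {r : ℕ} (K : Fin r → ℕ) (n : ℕ) : ℂ :=
  z n K (Complex.exp (2 * Real.pi * Complex.I / n))

/-- `ξ(K) = lim_{n → ∞} z_n(K; exp (2 π i / n))`. -/
noncomputable def xi {r : ℕ} (K : Fin r → ℕ) : ℂ :=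
  Filter.limUnder Filter.atTop (zSeq K)

/-- `I(k, r)`: the indices `(k_1, ..., k_r)` with positive entries, of weight `k` and depth `r`. -/
def indexSet (k r : ℕ) : Finset (Fin r → ℕ) :=
  (Finset.Nat.antidiagonalTuple r k).filter fun K => ∀ i, 1 ≤ K i

theorem mem_indexSet {k r : ℕ} (K : Fin r → ℕ) :
    K ∈ indexSet k r ↔ (∀ i, 1 ≤ K i) ∧ ∑ i, K i = k := by
  simp [indexSet, Finset.Nat.mem_antidiagonalTuple, and_comm]

theorem mem_decTuples {n r : ℕ} (m : Fin r → ℕ) :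
    m ∈ decTuples n r ↔ StrictAnti m ∧ ∀ i, 0 < m i ∧ m i < n := by
  simp [decTuples, and_comm]

end FiniteMHS

/-! Write `q = exp (2πi/n)`. Two independent matters are settled: the limits exist, and their sum
has a closed generating function.

Existence. A nested sum is a coordinate of the ordered product over `m < n` of the operators `1 + ∑
j, ε w_j(m) T_j`, with `T_j` shifting coordinate `j + 1` to `j`. Entries at least 2 contribute
`O(1/m²)` at distance `m` from either end of the range, which is summable. Entries equal to 1
contribute only `O(1/m)`, but all with the same scalar `x_m = 1/[m]_q`, so that together they form
`x_m • E` with `E` constant. Conjugating by exponentials of `E` times the partial sums of `x_m`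
removes this term (`descProd_gauged`, `gauged_eq`). The partial sums grow logarithmically, so
conjugation costs a power of `m`, and making `‖E‖` small keeps the new remainders `O(m^(-3/2))`.
Dominated convergence for ordered products (`exists_tendsto_descProd`) then applies, since the total
of the `x_m` converges by the symmetry `m ↔ n - m`.

Value. With `U = (1 - q) X`, summing a weight over its exponent gives `U / (1 - q^m (1 + U))`. Hence
the generating function in the depth is a product over roots of unity, evaluated by the
factorisation of `a^n - b^n` (`generating_identity`). As `n → ∞`, `(1 + U)^n` tends coefficientwise
to `e^(τX)` with `τ = -2πi`, and dividing by `e^(τX) - 1` produces the Bernoulli numbers. -/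

open Filter Topology

namespace FiniteMHS

/-! ### Ordered products in a normed ring -/

/-- The product `f (n - 1) * ⋯ * f 1 * f 0` in descending order. -/
def descProd {A : Type*} [Monoid A] (f : ℕ → A) : ℕ → A
  | 0 => 1
  | n + 1 => f n * descProd f n

theorem descProd_add {A : Type*} [Monoid A] (f : ℕ → A) (a b : ℕ) :
    descProd f (a + b) = descProd (fun i => f (a + i)) b * descProd f a := by
  induction b with
  | zero => simp [descProd]
  | succ b ih => rw [← add_assoc]; simp [descProd, ih, mul_assoc]

theorem exists_tendsto_descProd_of_fixed {A : Type*} [Monoid A] [TopologicalSpace A]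
    [ContinuousMul A] {f : ℕ → ℕ → A} {L : ℕ}
    (hf : ∀ m < L, ∃ a, Tendsto (fun n => f n m) atTop (𝓝 a)) :
    ∃ a, Tendsto (fun n => descProd (f n) L) atTop (𝓝 a) := by
  induction L with
  | zero => exact ⟨1, tendsto_const_nhds⟩
  | succ L ih =>
    obtain ⟨a, ha⟩ := ih fun m hm => hf m (by omega)
    obtain ⟨c, hc⟩ := hf L (by omega)
    exact ⟨c * a, hc.mul ha⟩

section Banach

variable {A : Type*} [NormedRing A] [NormOneClass A]

theorem norm_descProd_le (R : ℕ → A) (n : ℕ) :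
    ‖descProd (fun m => 1 + R m) n‖ ≤ Real.exp (∑ m ∈ Finset.range n, ‖R m‖) := by
  induction n with
  | zero => simp [descProd]
  | succ n ih =>
    rw [descProd, Finset.sum_range_succ, add_comm (∑ m ∈ _, _), Real.exp_add]
    refine (norm_mul_le _ _).trans (mul_le_mul ?_ ih (norm_nonneg _) (Real.exp_pos _).le)
    refine (norm_add_le _ _).trans ?_
    rw [norm_one, add_comm]
    exact Real.add_one_le_exp _

theorem norm_descProd_sub_one_le (R : ℕ → A) (n : ℕ) :
    ‖descProd (fun m => 1 + R m) n - 1‖ ≤ Real.exp (∑ m ∈ Finset.range n, ‖R m‖) - 1 := by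
  induction n with
  | zero => simp [descProd]
  | succ n ih =>
    have h : descProd (fun m => 1 + R m) (n + 1) - 1 =
        R n * descProd (fun m => 1 + R m) n + (descProd (fun m => 1 + R m) n - 1) := by
      rw [descProd, add_mul, one_mul]; abel
    rw [h, Finset.sum_range_succ]
    have h1 := norm_descProd_le R n
    have h2 := Real.add_one_le_exp ‖R n‖
    have h3 : ‖R n * descProd (fun m => 1 + R m) n‖ ≤
        ‖R n‖ * Real.exp (∑ m ∈ Finset.range n, ‖R m‖) :=
      (norm_mul_le _ _).trans (by gcongr)
    rw [Real.exp_add]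
    have h4 := Real.exp_pos (∑ m ∈ Finset.range n, ‖R m‖)
    have h5 := norm_add_le (R n * descProd (fun m => 1 + R m) n)
      (descProd (fun m => 1 + R m) n - 1)
    nlinarith

/-- Cut the range into blocks of lengths `L`, `n - 2L`, `L`. Each outer block has norm at most `exp
(2B)`, because `m` and `n - m` each run through distinct values. The middle block sees only the tail
of `b`, once from each end, and so is close to 1. -/
theorem norm_descProd_split_sub_le (R : ℕ → A) (b : ℕ → ℝ) (hb0 : ∀ m, 0 ≤ b m)
    (hb : Summable b) {n L : ℕ} (hn : 2 * L ≤ n) (hR : ∀ m < n, ‖R m‖ ≤ b m + b (n - m)) :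
    ‖descProd (fun m => 1 + R m) n -
      descProd (fun i => 1 + R (n - L + i)) L * descProd (fun m => 1 + R m) L‖ ≤
    Real.exp (4 * ∑' m, b m) * (Real.exp (2 * ∑' m, b (m + L)) - 1) := by
  set B := ∑' m, b m
  have hle : ∀ s : Finset ℕ, ∑ m ∈ s, b m ≤ B := fun s => hb.sum_le_tsum s fun i _ => hb0 i
  have hbL : Summable fun m => b (m + L) := (summable_nat_add_iff L).2 hb
  have hleL : ∀ s : Finset ℕ, ∑ m ∈ s, b (m + L) ≤ ∑' m, b (m + L) :=
    fun s => hbL.sum_le_tsum s fun i _ => hb0 _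
  have hlow : ∑ m ∈ Finset.range L, ‖R m‖ ≤ 2 * B := by
    calc ∑ m ∈ Finset.range L, ‖R m‖
        ≤ ∑ m ∈ Finset.range L, (b m + b (n - m)) :=
          Finset.sum_le_sum fun m hm => hR m (by have := Finset.mem_range.1 hm; omega)
      _ = ∑ m ∈ Finset.range L, b m + ∑ m ∈ (Finset.range L).image (n - ·), b m := by
          rw [Finset.sum_add_distrib, Finset.sum_image]
          intro i hi j hj hij
          simp only [Finset.coe_range, Set.mem_Iio] at hi hj hij
          omega
      _ ≤ 2 * B := by linarith [hle (Finset.range L), hle ((Finset.range L).image (n - ·))]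
  have hhigh : ∑ i ∈ Finset.range L, ‖R (n - L + i)‖ ≤ 2 * B := by
    calc ∑ i ∈ Finset.range L, ‖R (n - L + i)‖
        ≤ ∑ i ∈ Finset.range L, (b (n - L + i) + b (n - (n - L + i))) :=
          Finset.sum_le_sum fun m hm => hR _ (by have := Finset.mem_range.1 hm; omega)
      _ = ∑ m ∈ (Finset.range L).image (n - L + ·), b m +
            ∑ m ∈ (Finset.range L).image (fun i => n - (n - L + i)), b m := by
          rw [Finset.sum_add_distrib, Finset.sum_image, Finset.sum_image] <;>
          · intro i hi j hj hij
            simp only [Finset.coe_range, Set.mem_Iio] at hi hj hij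
            omega
      _ ≤ 2 * B := by
          linarith [hle ((Finset.range L).image (n - L + ·)),
            hle ((Finset.range L).image (fun i => n - (n - L + i)))]
  have hmid : ∑ i ∈ Finset.range (n - 2 * L), ‖R (L + i)‖ ≤ 2 * ∑' m, b (m + L) := by
    calc ∑ i ∈ Finset.range (n - 2 * L), ‖R (L + i)‖
        ≤ ∑ i ∈ Finset.range (n - 2 * L), (b (i + L) + b (n - 2 * L - i + L)) :=
          Finset.sum_le_sum fun i hi => by
            have := Finset.mem_range.1 hi
            have h := hR (L + i) (by omega)
            rwa [show n - (L + i) = n - 2 * L - i + L by omega, show b (L + i) = b (i + L) by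
              rw [add_comm]] at h
      _ = ∑ i ∈ Finset.range (n - 2 * L), b (i + L) +
            ∑ m ∈ (Finset.range (n - 2 * L)).image (n - 2 * L - ·), b (m + L) := by
          rw [Finset.sum_add_distrib, Finset.sum_image]
          intro i hi j hj hij
          simp only [Finset.coe_range, Set.mem_Iio] at hi hj hij
          omega
      _ ≤ _ := by
          linarith [hleL (Finset.range (n - 2 * L)),
            hleL ((Finset.range (n - 2 * L)).image (n - 2 * L - ·))]
  have hsplit : descProd (fun m => 1 + R m) n =
      descProd (fun i => 1 + R (n - L + i)) L *
        (descProd (fun i => 1 + R (L + i)) (n - 2 * L) * descProd (fun m => 1 + R m) L) := by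
    rw [← descProd_add (fun m => 1 + R m)]
    conv_lhs => rw [show n = (n - L) + L by omega, descProd_add]
    rw [show L + (n - 2 * L) = n - L by omega]
  rw [hsplit, ← mul_sub, ← sub_one_mul]
  have h1 := (norm_descProd_le (fun i => R (n - L + i)) L).trans (Real.exp_le_exp.2 hhigh)
  have h2 := (norm_descProd_le R L).trans (Real.exp_le_exp.2 hlow)
  have h3 := (norm_descProd_sub_one_le (fun i => R (L + i)) (n - 2 * L)).trans
    (sub_le_sub_right (Real.exp_le_exp.2 hmid) 1)
  have h3' := (norm_nonneg _).trans h3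
  calc _ ≤ Real.exp (2 * B) * ((Real.exp (2 * ∑' m, b (m + L)) - 1) * Real.exp (2 * B)) := by
        refine (norm_mul_le _ _).trans (mul_le_mul h1 ?_ (norm_nonneg _) (Real.exp_pos _).le)
        exact (norm_mul_le _ _).trans (mul_le_mul h3 h2 (norm_nonneg _) h3')
    _ = _ := by rw [show 4 * B = 2 * B + 2 * B by ring, Real.exp_add]; ring

/-- Dominated convergence for ordered products: the factors `1 + R n m` with `0 ≤ m < n`
are controlled by a summable function of the distance of `m` to the ends of the range. -/
theorem exists_tendsto_descProd [CompleteSpace A] (R : ℕ → ℕ → A) (b : ℕ → ℝ)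
    (hb0 : ∀ m, 0 ≤ b m) (hb : Summable b)
    (hR : ∀ n, ∀ m < n, ‖R n m‖ ≤ b m + b (n - m))
    (hl : ∀ m, ∃ a, Tendsto (fun n => R n m) atTop (𝓝 a))
    (hr : ∀ l, 1 ≤ l → ∃ a, Tendsto (fun n => R n (n - l)) atTop (𝓝 a)) :
    ∃ a, Tendsto (fun n => descProd (fun m => 1 + R n m) n) atTop (𝓝 a) := by
  refine cauchySeq_tendsto_of_complete (Metric.cauchySeq_iff.2 fun ε hε => ?_)
  have htail : Tendsto (fun L => Real.exp (4 * ∑' m, b m) *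
      (Real.exp (2 * ∑' m, b (m + L)) - 1)) atTop (𝓝 0) := by
    have h := (((Real.continuous_exp.tendsto _).comp
      ((tendsto_sum_nat_add b).const_mul 2)).sub_const 1).const_mul (Real.exp (4 * ∑' m, b m))
    simpa using h
  -- The cutoff `L` is uniform in `n`. With `L` fixed, only `L` factors at each end remain, and
  -- these converge one by one.
  obtain ⟨L, hL⟩ := (htail.eventually (gt_mem_nhds (show 0 < ε / 3 by positivity))).exists
  obtain ⟨a, ha⟩ := exists_tendsto_descProd_of_fixed (f := fun n m => 1 + R n m) (L := L)
    fun m _ => (hl m).imp' (1 + ·) fun _ h => h.const_add 1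
  obtain ⟨c, hc⟩ := exists_tendsto_descProd_of_fixed
    (f := fun n i => 1 + R n (n - L + i)) (L := L) fun i hi => by
      obtain ⟨d, hd⟩ := hr (L - i) (by omega)
      refine ⟨1 + d, (hd.congr' ?_).const_add 1⟩
      filter_upwards [eventually_ge_atTop L] with n hn
      rw [show n - (L - i) = n - L + i by omega]
  obtain ⟨N, hN⟩ := Metric.cauchySeq_iff.1 (hc.mul ha).cauchySeq (ε / 3) (by positivity)
  have key : ∀ n, 2 * L ≤ n → dist (descProd (fun m => 1 + R n m) n)
      (descProd (fun i => 1 + R n (n - L + i)) L * descProd (fun m => 1 + R n m) L) < ε / 3 :=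
    fun n hn => by
      rw [dist_eq_norm]
      exact (norm_descProd_split_sub_le (R n) b hb0 hb hn (hR n)).trans_lt hL
  refine ⟨max N (2 * L), fun m hm n hn => ?_⟩
  have h1 := key m (le_of_max_le_right hm)
  have h2 := key n (le_of_max_le_right hn)
  have h3 := hN m (le_of_max_le_left hm) n (le_of_max_le_left hn)
  rw [dist_comm] at h2
  refine (dist_triangle4 _ _ _ _).trans_lt
    ((add_lt_add (add_lt_add h1 h3) h2).trans_eq (by ring))

end Banach

/-! ### Exponential estimates in a Banach algebra -/

section Exp

variable {A : Type*} [NormedRing A] [NormOneClass A] [NormedAlgebra ℂ A] [CompleteSpace A]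

theorem norm_exp_le_exp_norm (y : A) : ‖NormedSpace.exp y‖ ≤ Real.exp ‖y‖ := by
  have h := NormedSpace.exp_series_hasSum_exp' (𝕂 := ℂ) y
  have h' := NormedSpace.exp_series_hasSum_exp' (𝕂 := ℝ) ‖y‖
  rw [← Real.exp_eq_exp_ℝ] at h'
  refine h.norm_le_of_bounded h' fun n => ?_
  rw [norm_smul, norm_inv, smul_eq_mul, Complex.norm_natCast]
  gcongr
  exact norm_pow_le _ _

theorem norm_exp_sub_one_sub_le {y : A} (hy : ‖y‖ ≤ 1) :
    ‖NormedSpace.exp y - 1 - y‖ ≤ ‖y‖ ^ 2 := by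
  have h := (hasSum_nat_add_iff' 2).2 (NormedSpace.exp_series_hasSum_exp' (𝕂 := ℂ) y)
  have h' := (hasSum_nat_add_iff' 2).2 (NormedSpace.exp_series_hasSum_exp' (𝕂 := ℝ) ‖y‖)
  rw [← Real.exp_eq_exp_ℝ] at h'
  have h1 := h.norm_le_of_bounded h' fun n => by
    rw [norm_smul, norm_inv, smul_eq_mul, Complex.norm_natCast]
    gcongr
    exact norm_pow_le _ _
  have h2 := Real.norm_exp_sub_one_sub_id_le (x := ‖y‖) (by simpa using hy)
  simp only [Finset.sum_range_succ, Finset.sum_range_zero, Nat.factorial, pow_zero, pow_one,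
    Nat.cast_one, inv_one, one_smul, zero_add, mul_one, ← sub_sub] at h1
  refine h1.trans ((le_abs_self _).trans ?_)
  simpa using h2

end Exp

/-! ### Removing the non-summable term by a gauge transform -/

section Gauge

variable {A : Type*} [NormedRing A] [NormedAlgebra ℂ A] [CompleteSpace A]

theorem exp_neg_smul_mul_exp_smul (E : A) (h : ℂ) :
    NormedSpace.exp (-h • E) * NormedSpace.exp (h • E) = 1 := by
  let _ : NormedAlgebra ℚ A := NormedAlgebra.restrictScalars ℚ ℂ A
  rw [← NormedSpace.exp_add_of_commute (((Commute.refl E).smul_left _).smul_right _), ← add_smul]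
  simp

theorem exp_neg_add_smul (E : A) (h x : ℂ) :
    NormedSpace.exp (-(h + x) • E) = NormedSpace.exp (-h • E) * NormedSpace.exp (-x • E) := by
  let _ : NormedAlgebra ℚ A := NormedAlgebra.restrictScalars ℚ ℂ A
  rw [← NormedSpace.exp_add_of_commute (((Commute.refl E).smul_left _).smul_right _), ← add_smul,
    neg_add]

theorem tendsto_exp_smul {E : A} {f : ℕ → ℂ} {a : ℂ} (hf : Tendsto f atTop (𝓝 a)) :
    Tendsto (fun n => NormedSpace.exp (f n • E)) atTop (𝓝 (NormedSpace.exp (a • E))) := by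
  let _ : NormedAlgebra ℚ A := NormedAlgebra.restrictScalars ℚ ℂ A
  exact (hf.smul_const E).exp

/-- The gauge transform of the step `1 + x • E + f` by the exponentials of `h • E`
and `(h + x) • E`. -/
noncomputable def gauged (E : A) (h x : ℂ) (f : A) : A :=
  NormedSpace.exp (-(h + x) • E) * (1 + x • E + f) * NormedSpace.exp (h • E) - 1

/-- The interior exponentials cancel in adjacent factors, and the one at the right end is `exp 0 =
1`. -/
theorem descProd_gauged (E : A) (x : ℕ → ℂ) (F : ℕ → A) (n : ℕ) :
    descProd (fun m => 1 + gauged E (∑ j ∈ Finset.range m, x j) (x m) (F m)) n =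
      NormedSpace.exp (-(∑ j ∈ Finset.range n, x j) • E) *
        descProd (fun m => 1 + x m • E + F m) n := by
  induction n with
  | zero => simp [descProd]
  | succ n ih =>
    have h := exp_neg_smul_mul_exp_smul E (-∑ j ∈ Finset.range n, x j)
    rw [neg_neg] at h
    rw [descProd, ih, descProd, gauged, Finset.sum_range_succ, add_sub_cancel, mul_assoc,
      mul_assoc, ← mul_assoc (NormedSpace.exp ((∑ j ∈ Finset.range n, x j) • E)), h, one_mul]

/-- Since `E` commutes with its exponentials, the part without `f` collapses to `exp (-xE) (1 +
xE)`. Subtracting `1 = exp (-xE) exp (xE)` leaves only the second-order remainder of the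
exponential. -/
theorem gauged_eq (E : A) (h x : ℂ) (f : A) :
    gauged E h x f = NormedSpace.exp (-(h + x) • E) * f * NormedSpace.exp (h • E) -
      NormedSpace.exp (-x • E) * (NormedSpace.exp (x • E) - 1 - x • E) := by
  have h1 := exp_neg_smul_mul_exp_smul E h
  have h2 := exp_neg_smul_mul_exp_smul E x
  have hc : NormedSpace.exp (-(h + x) • E) * (1 + x • E) * NormedSpace.exp (h • E) =
      NormedSpace.exp (-x • E) * (1 + x • E) := by
    let _ : NormedAlgebra ℚ A := NormedAlgebra.restrictScalars ℚ ℂ A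
    have hcomm : Commute (NormedSpace.exp (-h • E)) (NormedSpace.exp (-x • E) * (1 + x • E)) := by
      have hE : Commute (NormedSpace.exp (-h • E)) E :=
        (((Commute.refl E).smul_left (-h)).exp_left)
      exact ((((Commute.refl E).smul_left _).smul_right _).exp).mul_right
        ((Commute.one_right _).add_right (hE.smul_right x))
    rw [exp_neg_add_smul, mul_assoc (NormedSpace.exp (-h • E)), hcomm.eq, mul_assoc, h1, mul_one]
  rw [gauged, mul_add, add_mul, hc, mul_sub, mul_sub, h2, mul_add]
  abel_nf

variable [NormOneClass A] in
-- The exponentials cost at most `exp ((14 + 4 log μ) / 8) ≤ e² μ^(1/2)`, so `f = O(μ⁻²)` becomes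
-- `O(μ^(-3/2))`, still summable. This is why `‖E‖ ≤ 1/8` is imposed.
theorem norm_gauged_le {E : A} (hE : ‖E‖ ≤ 1 / 8) {h x : ℂ} {f : A} {C μ : ℝ} (hC : 0 ≤ C)
    (hμ : 1 ≤ μ) (hx : ‖x‖ ≤ 2 / μ) (hf : ‖f‖ ≤ C / μ ^ 2)
    (hh : ‖h‖ + ‖h + x‖ ≤ 14 + 4 * Real.log μ) :
    ‖gauged E h x f‖ ≤ (1 + C * Real.exp 2) * (1 / μ ^ (3 / 2 : ℝ)) := by
  have hμ0 : 0 < μ := by linarith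
  have hsmul : ∀ c : ℂ, ‖NormedSpace.exp (c • E)‖ ≤ Real.exp (‖c‖ / 8) := fun c => by
    refine (norm_exp_le_exp_norm _).trans (Real.exp_le_exp.2 ?_)
    rw [norm_smul]
    nlinarith [norm_nonneg c]
  have hpow : Real.exp (Real.log μ / 2) / μ ^ 2 = 1 / μ ^ (3 / 2 : ℝ) := by
    rw [div_eq_div_iff (by positivity) (by positivity), Real.rpow_def_of_pos hμ0, one_mul,
      ← Real.exp_add, ← Real.exp_log (pow_pos hμ0 2), Real.log_pow]
    congr 1
    push_cast
    ring
  have h1 : ‖NormedSpace.exp (-(h + x) • E) * f * NormedSpace.exp (h • E)‖ ≤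
      C * Real.exp 2 * (1 / μ ^ (3 / 2 : ℝ)) := by
    calc _ ≤ Real.exp (‖h + x‖ / 8) * (C / μ ^ 2) * Real.exp (‖h‖ / 8) := by
          refine (norm_mul_le _ _).trans (mul_le_mul ((norm_mul_le _ _).trans ?_) (hsmul h)
            (norm_nonneg _) (by positivity))
          have := hsmul (-(h + x))
          rw [norm_neg] at this
          exact mul_le_mul this hf (norm_nonneg _) (by positivity)
      _ = C / μ ^ 2 * Real.exp ((‖h‖ + ‖h + x‖) / 8) := by
          rw [add_div, Real.exp_add]; ring
      _ ≤ C / μ ^ 2 * (Real.exp 2 * Real.exp (Real.log μ / 2)) := by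
          rw [← Real.exp_add]
          gcongr
          linarith
      _ = C * Real.exp 2 * (Real.exp (Real.log μ / 2) / μ ^ 2) := by ring
      _ = _ := by rw [hpow]
  have h2 : ‖NormedSpace.exp (-x • E) * (NormedSpace.exp (x • E) - 1 - x • E)‖ ≤
      1 / μ ^ (3 / 2 : ℝ) := by
    have hx2 : ‖x‖ ≤ 2 := hx.trans ((div_le_iff₀ hμ0).2 (by linarith))
    have hxE : ‖x • E‖ ≤ 1 / 4 / μ := by
      rw [norm_smul]
      calc ‖x‖ * ‖E‖ ≤ 2 / μ * (1 / 8) := by gcongr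
        _ = _ := by ring
    have hxE1 : ‖x • E‖ ≤ 1 := hxE.trans ((div_le_iff₀ hμ0).2 (by linarith))
    calc _ ≤ Real.exp 1 * (1 / 4 / μ) ^ 2 := by
          refine (norm_mul_le _ _).trans (mul_le_mul ?_ ?_ (norm_nonneg _) (by positivity))
          · refine (hsmul _).trans (Real.exp_le_exp.2 ?_)
            rw [norm_neg]; linarith
          · exact (norm_exp_sub_one_sub_le hxE1).trans (by gcongr)
      _ ≤ 1 * (1 / μ ^ 2) := by
          have := Real.exp_one_lt_d9
          rw [show (1 / 4 / μ) ^ 2 = 1 / 16 * (1 / μ ^ 2) by ring, ← mul_assoc]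
          gcongr
          linarith
      _ ≤ _ := by
          rw [one_mul]
          gcongr
          rw [← Real.rpow_natCast]
          exact Real.rpow_le_rpow_of_exponent_le hμ (by norm_num)
  rw [gauged_eq]
  refine (norm_sub_le _ _).trans ?_
  linarith

theorem norm_sum_range_le_log {x : ℕ → ℂ} {m : ℕ} (h : ∀ j < m, ‖x j‖ ≤ 2 / (j + 1)) :
    ‖∑ j ∈ Finset.range m, x j‖ ≤ 2 * (1 + Real.log m) := by
  refine (norm_sum_le_of_le _ fun j hj => h j (Finset.mem_range.1 hj)).trans ?_
  have h1 := harmonic_le_one_add_log m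
  simp only [harmonic, Rat.cast_sum, Rat.cast_inv, Rat.cast_natCast] at h1
  refine (le_of_eq ?_).trans (mul_le_mul_of_nonneg_left h1 zero_le_two)
  rw [Finset.mul_sum]
  refine Finset.sum_congr rfl fun j _ => ?_
  push_cast
  rw [div_eq_mul_inv]

variable [NormOneClass A] in
-- The gauged factors satisfy the dominated convergence criterion. The original product is recovered
-- through the exponential of the total sum, which converges by `hs`.
theorem exists_tendsto_descProd_add (E : A) (hE : ‖E‖ ≤ 1 / 8) (x : ℕ → ℕ → ℂ) (F : ℕ → ℕ → A)
    (C : ℝ) (hC : 0 ≤ C) (hx0 : ∀ n, x n 0 = 0) (hF0 : ∀ n, F n 0 = 0)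
    (hx1 : ∀ n m, 0 < m → 2 * m ≤ n → ‖x n m‖ ≤ 2 / m)
    (hx2 : ∀ n l, 0 < l → 2 * l ≤ n → ‖x n (n - l)‖ ≤ 2 / l)
    (hF1 : ∀ n m, 0 < m → 2 * m ≤ n → ‖F n m‖ ≤ C / m ^ 2)
    (hF2 : ∀ n l, 0 < l → 2 * l ≤ n → ‖F n (n - l)‖ ≤ C / l ^ 2)
    (hxl : ∀ m, ∃ a, Tendsto (fun n => x n m) atTop (𝓝 a))
    (hxr : ∀ l, 1 ≤ l → ∃ a, Tendsto (fun n => x n (n - l)) atTop (𝓝 a))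
    (hFl : ∀ m, ∃ a, Tendsto (fun n => F n m) atTop (𝓝 a))
    (hFr : ∀ l, 1 ≤ l → ∃ a, Tendsto (fun n => F n (n - l)) atTop (𝓝 a))
    (hs : ∃ a, Tendsto (fun n => ∑ j ∈ Finset.range n, x n j) atTop (𝓝 a))
    (hs4 : ∀ n, ‖∑ j ∈ Finset.range n, x n j‖ ≤ 4) :
    ∃ a, Tendsto (fun n => descProd (fun m => 1 + x n m • E + F n m) n) atTop (𝓝 a) := by
  set h : ℕ → ℕ → ℂ := fun n m => ∑ j ∈ Finset.range m, x n j with hdef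
  have hsucc : ∀ n m, h n m + x n m = h n (m + 1) := fun n m =>
    (Finset.sum_range_succ _ _).symm
  have hlow : ∀ n m, 0 < m → 2 * m ≤ n → ‖h n (m + 1)‖ ≤ 2 * (1 + Real.log m) :=
    fun n m hm hmn => by
      rw [hdef]
      simp only [Finset.sum_range_succ', hx0, add_zero]
      refine norm_sum_range_le_log fun j hj => ?_
      exact_mod_cast hx1 n (j + 1) (by omega) (by omega)
  have hhigh : ∀ n l, 0 < l → 2 * l ≤ n → ‖h n (n - l)‖ ≤ 4 + 2 * (1 + Real.log l) :=
    fun n l hl hln => by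
      -- Near the right end the partial sum is the bounded total minus the last `l` terms, hence
      -- again logarithmic in `l`. With the total at most 4, this gives the constant `14 = 6 + 6 +
      -- 2` of `norm_gauged_le`.
      have hsplit : h n (n - l) =
          ∑ j ∈ Finset.range n, x n j - ∑ j ∈ Finset.range l, x n (n - (j + 1)) := by
        rw [← Finset.sum_range_reflect (fun j => x n (n - (j + 1))), eq_sub_iff_add_eq]
        conv_rhs => rw [show n = n - l + l by omega, Finset.sum_range_add]
        rw [show n - l + l = n by omega]
        congr 1
        refine Finset.sum_congr rfl fun j hj => ?_
        have := Finset.mem_range.1 hj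
        congr 1
        omega
      rw [hsplit]
      refine (norm_sub_le _ _).trans (add_le_add (hs4 n) (norm_sum_range_le_log fun j hj => ?_))
      exact_mod_cast hx2 n (j + 1) (by omega) (by omega)
  set D := 1 + C * Real.exp 2
  have hD : 0 ≤ D := by positivity
  have hb1 : ∀ n m, 0 < m → 2 * m ≤ n →
      ‖gauged E (h n m) (x n m) (F n m)‖ ≤ D * (1 / (m : ℝ) ^ (3 / 2 : ℝ)) := fun n m hm hmn => by
    have hm1 : (1 : ℝ) ≤ m := by exact_mod_cast hm
    have hxm := hx1 n m hm hmn
    have hxm2 : (2 : ℝ) / m ≤ 2 := (div_le_iff₀ (by linarith)).2 (by linarith)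
    have h1 := hlow n m hm hmn
    refine norm_gauged_le hE hC hm1 hxm (hF1 n m hm hmn) ?_
    have h2 : ‖h n m‖ ≤ ‖h n (m + 1)‖ + ‖x n m‖ := by
      rw [← hsucc]; simpa using norm_sub_le (h n m + x n m) (x n m)
    rw [hsucc]
    linarith
  have hb2 : ∀ n l, 0 < l → 2 * l ≤ n →
      ‖gauged E (h n (n - l)) (x n (n - l)) (F n (n - l))‖ ≤ D * (1 / (l : ℝ) ^ (3 / 2 : ℝ)) :=
    fun n l hl hln => by
      have hl1 : (1 : ℝ) ≤ l := by exact_mod_cast hl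
      have hxm := hx2 n l hl hln
      have hxm2 : (2 : ℝ) / l ≤ 2 := (div_le_iff₀ (by linarith)).2 (by linarith)
      have h1 := hhigh n l hl hln
      refine norm_gauged_le hE hC hl1 hxm (hF2 n l hl hln) ?_
      have h2 := norm_add_le (h n (n - l)) (x n (n - l))
      linarith
  have hsum : Summable fun m : ℕ => D * (1 / (m : ℝ) ^ (3 / 2 : ℝ)) :=
    (Real.summable_one_div_nat_rpow.2 (by norm_num)).mul_left D
  have hb0 : ∀ m : ℕ, 0 ≤ D * (1 / (m : ℝ) ^ (3 / 2 : ℝ)) := fun m => by positivity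
  have htend : ∀ f : ℕ → ℕ, (∃ a, Tendsto (fun n => h n (f n)) atTop (𝓝 a)) →
      (∃ a, Tendsto (fun n => x n (f n)) atTop (𝓝 a)) →
      (∃ a, Tendsto (fun n => F n (f n)) atTop (𝓝 a)) →
      ∃ a, Tendsto (fun n => gauged E (h n (f n)) (x n (f n)) (F n (f n))) atTop (𝓝 a) := by
    rintro f ⟨a, ha⟩ ⟨b, hb⟩ ⟨c, hc⟩
    exact ⟨_, (((tendsto_exp_smul (ha.add hb).neg).mul
      (((hb.smul_const E).const_add 1).add hc)).mul (tendsto_exp_smul ha)).sub_const 1⟩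
  obtain ⟨a, ha⟩ := exists_tendsto_descProd
    (fun n m => gauged E (h n m) (x n m) (F n m)) _ hb0 hsum (fun n m hmn => by
      rcases Nat.eq_zero_or_pos m with rfl | hm
      -- At `m = 0` the step is 1 and both exponentials are trivial.
      · have : gauged E (h n 0) (x n 0) (F n 0) = 0 := by simp [gauged, hdef, hx0, hF0]
        rw [this, norm_zero]
        exact add_nonneg (hb0 _) (hb0 _)
      · rcases le_or_gt (2 * m) n with h2 | h2
        · exact (hb1 n m hm h2).trans (le_add_of_nonneg_right (hb0 _))
        · have := hb2 n (n - m) (by omega) (by omega)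
          rw [show n - (n - m) = m by omega] at this
          exact this.trans (le_add_of_nonneg_left (hb0 _)))
    (fun m => htend (fun _ => m) (by
      choose g hg using hxl
      exact ⟨_, tendsto_finsetSum _ fun j _ => hg j⟩) (hxl m) (hFl m))
    (fun l hl => htend (fun n => n - l) (by
      choose! g hg using hxr
      obtain ⟨s, hs⟩ := hs
      refine ⟨s - ∑ i ∈ Finset.range l, g (l - i), (hs.sub (tendsto_finsetSum (Finset.range l)
        fun i hi => hg (l - i) (by have := Finset.mem_range.1 hi; omega))).congr' ?_⟩
      filter_upwards [eventually_ge_atTop l] with n hn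
      rw [sub_eq_iff_eq_add]
      conv_lhs => rw [show n = n - l + l by omega, Finset.sum_range_add]
      rw [show n - l + l = n by omega]
      congr 1
      refine Finset.sum_congr rfl fun i hi => ?_
      have := Finset.mem_range.1 hi
      congr 1
      omega) (hxr l hl) (hFr l hl))
  obtain ⟨s, hs⟩ := hs
  refine ⟨_, ((tendsto_exp_smul (E := E) hs).mul ha).congr fun n => ?_⟩
  have h1 := exp_neg_smul_mul_exp_smul E (-∑ j ∈ Finset.range n, x n j)
  rw [neg_neg] at h1
  rw [descProd_gauged, ← mul_assoc, h1, one_mul]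

end Gauge

/-! ### Nested sums and their recursion -/

section Nested

variable {R : Type*} [CommSemiring R]

/-- The nested sum of `∏ j, w j (m_j)` over `n > m_0 > ⋯ > m_{r-1} > 0`. -/
noncomputable def nestedSum (w : ℕ → ℕ → R) (r n : ℕ) : R :=
  ∑ m ∈ decTuples n r, ∏ j : Fin r, w j (m j)

theorem sum_decTuples_succ (n r : ℕ) (f : (Fin (r + 1) → ℕ) → R) :
    ∑ m ∈ decTuples n (r + 1), f m =
      ∑ a ∈ Finset.Ioo 0 n, ∑ m ∈ decTuples a r, f (Fin.cons a m) := by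
  rw [Finset.sum_sigma']
  refine Finset.sum_bij' (fun m _ => ⟨m 0, Fin.tail m⟩) (fun p _ => Fin.cons p.1 p.2) ?_ ?_ ?_ ?_ ?_
  · intro m hm
    rw [mem_decTuples] at hm
    simp only [Finset.mem_sigma, Finset.mem_Ioo, mem_decTuples]
    exact ⟨hm.2 0, fun i j hij => hm.1 (Fin.succ_lt_succ_iff.2 hij),
      fun i => ⟨(hm.2 _).1, hm.1 (Fin.succ_pos i)⟩⟩
  · rintro ⟨a, m⟩ hm
    simp only [Finset.mem_sigma, Finset.mem_Ioo, mem_decTuples] at hm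
    rw [mem_decTuples]
    refine ⟨?_, fun i => ?_⟩
    · rw [Fin.strictAnti_iff_succ_lt]
      intro i
      rcases Fin.eq_zero_or_eq_succ i.castSucc with h | ⟨j, h⟩
      · rw [h]; simpa using (hm.2.2 i).2
      · rw [h]
        simp only [Fin.cons_succ]
        refine hm.2.1 ?_
        rw [Fin.lt_def]
        have := congrArg Fin.val h
        simp at this
        omega
    · refine Fin.cases ?_ (fun i => ?_) i
      · simpa using hm.1
      · have := hm.2.2 i
        simp only [Fin.cons_succ]
        omega
  · intro m _; simp
  · rintro ⟨a, m⟩ _; simp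
  · intro m _; simp

theorem nestedSum_zero_left (w : ℕ → ℕ → R) (n : ℕ) : nestedSum w 0 n = 1 := by
  have : decTuples n 0 = {Fin.elim0} := by
    ext m
    rw [mem_decTuples, Finset.mem_singleton]
    exact ⟨fun _ => Subsingleton.elim _ _, fun _ => ⟨fun i => i.elim0, fun i => i.elim0⟩⟩
  simp [nestedSum, this]

theorem nestedSum_succ_left (w : ℕ → ℕ → R) (r n : ℕ) :
    nestedSum w (r + 1) n =
      ∑ a ∈ Finset.Ioo 0 n, w 0 a * nestedSum (fun j => w (j + 1)) r a := by
  rw [nestedSum, sum_decTuples_succ]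
  refine Finset.sum_congr rfl fun a _ => ?_
  rw [nestedSum, Finset.mul_sum]
  refine Finset.sum_congr rfl fun m _ => ?_
  rw [Fin.prod_univ_succ]
  simp

theorem nestedSum_succ_zero (w : ℕ → ℕ → R) (r : ℕ) : nestedSum w (r + 1) 0 = 0 := by
  simp [nestedSum_succ_left]

/-- Separate the tuples whose largest entry is `n`. The condition on `w 0 0` covers `n = 0`, where
the range stays empty but the recursion would add `w 0 0`. -/
theorem nestedSum_succ_succ (w : ℕ → ℕ → R) (r n : ℕ) (hw : w 0 0 = 0) :
    nestedSum w (r + 1) (n + 1) =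
      nestedSum w (r + 1) n + w 0 n * nestedSum (fun j => w (j + 1)) r n := by
  rcases Nat.eq_zero_or_pos n with rfl | hn
  · simp [nestedSum_succ_left, hw, show Finset.Ioo 0 1 = ∅ from rfl]
  · rw [nestedSum_succ_left, nestedSum_succ_left, add_comm (∑ a ∈ _, _)]
    have : Finset.Ioo 0 (n + 1) = insert n (Finset.Ioo 0 n) := by
      ext a; simp only [Finset.mem_insert, Finset.mem_Ioo]; omega
    rw [this, Finset.sum_insert (by simp)]

end Nested

/-! ### The weights at roots of unity -/

/-- The factor `q ^ ((k - 1) m) / [m]_q ^ k`. -/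
noncomputable def weight (q : ℂ) (k m : ℕ) : ℂ := q ^ ((k - 1) * m) / qInt q m ^ k

/-- The primitive root of unity `exp (2 π i / n)`. -/
noncomputable def rootOfUnity (n : ℕ) : ℂ := Complex.exp (2 * Real.pi * Complex.I / n)

/-- Here `[0]_q = 0` and division by zero gives 0, so ordered products may start at `m = 0`. -/
theorem weight_zero (q : ℂ) {k : ℕ} (hk : 1 ≤ k) : weight q k 0 = 0 := by
  simp [weight, qInt, show k ≠ 0 by omega]

theorem weight_one (q : ℂ) (m : ℕ) : weight q 1 m = (qInt q m)⁻¹ := by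
  simp [weight]

theorem rootOfUnity_pow (n m : ℕ) :
    rootOfUnity n ^ m = Complex.exp (Complex.I * ((2 * Real.pi * m / n : ℝ) : ℂ)) := by
  rw [rootOfUnity, ← Complex.exp_nat_mul]
  congr 1
  push_cast
  ring

theorem norm_rootOfUnity (n : ℕ) : ‖rootOfUnity n‖ = 1 := by
  have h := rootOfUnity_pow n 1
  rw [pow_one] at h
  rw [h, mul_comm, Complex.norm_exp_ofReal_mul_I]

theorem isPrimitiveRoot_rootOfUnity {n : ℕ} (hn : n ≠ 0) : IsPrimitiveRoot (rootOfUnity n) n :=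
  Complex.isPrimitiveRoot_exp n hn

theorem rootOfUnity_ne_zero (n : ℕ) : rootOfUnity n ≠ 0 := Complex.exp_ne_zero _

theorem rootOfUnity_ne_one {n : ℕ} (hn : 2 ≤ n) : rootOfUnity n ≠ 1 :=
  (isPrimitiveRoot_rootOfUnity (by omega)).ne_one (by omega)

theorem qInt_eq_sum {q : ℂ} (hq : q ≠ 1) (m : ℕ) : qInt q m = ∑ i ∈ Finset.range m, q ^ i := by
  rw [geom_sum_eq hq, qInt, ← neg_div_neg_eq, neg_sub, neg_sub]

theorem rootOfUnity_pow_sub {n l : ℕ} (hl : l ≤ n) :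
    rootOfUnity n ^ (n - l) = (rootOfUnity n ^ l)⁻¹ := by
  rcases Nat.eq_zero_or_pos n with rfl | hn
  · simp [show l = 0 by omega]
  · refine eq_inv_of_mul_eq_one_left ?_
    rw [← pow_add,
      Nat.sub_add_cancel hl, (isPrimitiveRoot_rootOfUnity hn.ne').pow_eq_one]

theorem qInt_rootOfUnity_sub {n l : ℕ} (hl : l ≤ n) :
    qInt (rootOfUnity n) (n - l) = -((rootOfUnity n ^ l)⁻¹ * qInt (rootOfUnity n) l) := by
  have h := pow_ne_zero l (rootOfUnity_ne_zero n)
  rw [qInt, qInt, rootOfUnity_pow_sub hl, mul_div_assoc', ← neg_div]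
  congr 1
  field_simp
  ring

theorem norm_one_sub_rootOfUnity_le (n : ℕ) : ‖1 - rootOfUnity n‖ ≤ 2 * Real.pi / n := by
  have h := Real.norm_exp_I_mul_ofReal_sub_one_le (x := 2 * Real.pi * (1 : ℕ) / n)
  rw [← rootOfUnity_pow, pow_one, norm_sub_rev] at h
  refine h.trans (le_of_eq ?_)
  rw [Real.norm_of_nonneg (by positivity)]
  simp

/-- Jordan's inequality gives `|1 - q^m| ≥ 4m/n` for `m ≤ n/2`, while `|1 - q| ≤ 2π/n`. The ratio is
at most `π/(2m)`. -/
theorem norm_inv_qInt_le {n m : ℕ} (hm : 0 < m) (hmn : 2 * m ≤ n) :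
    ‖(qInt (rootOfUnity n) m)⁻¹‖ ≤ 2 / m := by
  have hm0 : (0 : ℝ) < m := by exact_mod_cast hm
  have hn0 : (0 : ℝ) < n := by exact_mod_cast (show 0 < n by omega)
  have hmn' : 2 * (m : ℝ) ≤ n := by exact_mod_cast hmn
  have h1 := norm_one_sub_rootOfUnity_le n
  have h2 : 4 * m / n ≤ ‖1 - rootOfUnity n ^ m‖ := by
    rw [norm_sub_rev, rootOfUnity_pow, Complex.norm_exp_I_mul_ofReal_sub_one]
    have h := Real.mul_le_sin (x := 2 * Real.pi * m / n / 2) (by positivity) (by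
      rw [div_right_comm]
      rw [div_le_iff₀ hn0]
      nlinarith [Real.pi_pos])
    refine le_trans ?_ (Real.le_norm_self _)
    refine le_trans (le_of_eq ?_) (mul_le_mul_of_nonneg_left h zero_le_two)
    field_simp
    ring
  have h3 : 0 < 4 * m / (n : ℝ) := by positivity
  rw [qInt, inv_div, norm_div]
  calc ‖1 - rootOfUnity n‖ / ‖1 - rootOfUnity n ^ m‖ ≤ 2 * Real.pi / n / (4 * m / n) := by
        gcongr
    _ = Real.pi / 2 / m := by field_simp; ring
    _ ≤ 2 / m := by
        gcongr
        linarith [Real.pi_lt_four]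

theorem norm_inv_qInt_sub_le {n l : ℕ} (hl : 0 < l) (hln : 2 * l ≤ n) :
    ‖(qInt (rootOfUnity n) (n - l))⁻¹‖ ≤ 2 / l := by
  rw [qInt_rootOfUnity_sub (by omega)]
  have := norm_inv_qInt_le hl hln
  simpa [norm_rootOfUnity] using this

theorem norm_weight (n k m : ℕ) :
    ‖weight (rootOfUnity n) k m‖ = ‖(qInt (rootOfUnity n) m)⁻¹‖ ^ k := by
  simp [weight, norm_rootOfUnity]

theorem norm_weight_le {n k m l : ℕ} (hk : 2 ≤ k) (hl : 0 < l)
    (h : ‖(qInt (rootOfUnity n) m)⁻¹‖ ≤ 2 / l) :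
    ‖weight (rootOfUnity n) k m‖ ≤ 2 ^ k / (l : ℝ) ^ 2 := by
  have hl1 : (1 : ℝ) ≤ l := by exact_mod_cast hl
  rw [norm_weight]
  calc _ ≤ (2 / (l : ℝ)) ^ k := by gcongr
    _ = 2 ^ k / (l : ℝ) ^ k := div_pow _ _ _
    _ ≤ _ := by gcongr

theorem tendsto_rootOfUnity : Tendsto rootOfUnity atTop (𝓝 1) := by
  have h : Tendsto (fun n : ℕ => 2 * Real.pi * Complex.I / (n : ℂ)) atTop (𝓝 0) :=
    tendsto_const_div_atTop_nhds_zero_nat _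
  have h' := (Complex.continuous_exp.tendsto 0).comp h
  rwa [Complex.exp_zero] at h'

theorem tendsto_qInt (m : ℕ) : Tendsto (fun n => qInt (rootOfUnity n) m) atTop (𝓝 m) := by
  have h : Tendsto (fun n => ∑ i ∈ Finset.range m, rootOfUnity n ^ i) atTop (𝓝 m) := by
    simpa using tendsto_finsetSum (Finset.range m) fun i _ => tendsto_rootOfUnity.pow i
  refine h.congr' ?_
  filter_upwards [eventually_ge_atTop 2] with n hn
  exact (qInt_eq_sum (rootOfUnity_ne_one hn) m).symm

theorem exists_tendsto_weight {k : ℕ} (hk : 1 ≤ k) (m : ℕ) :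
    ∃ a, Tendsto (fun n => weight (rootOfUnity n) k m) atTop (𝓝 a) := by
  rcases Nat.eq_zero_or_pos m with rfl | hm
  · simp only [weight_zero _ hk]
    exact ⟨0, tendsto_const_nhds⟩
  · exact ⟨_, (tendsto_rootOfUnity.pow _).div ((tendsto_qInt m).pow k)
      (pow_ne_zero _ (by exact_mod_cast hm.ne'))⟩

theorem exists_tendsto_weight_sub (k : ℕ) {l : ℕ} (hl : 1 ≤ l) :
    ∃ a, Tendsto (fun n => weight (rootOfUnity n) k (n - l)) atTop (𝓝 a) := by
  have hinv : Tendsto (fun n => (rootOfUnity n ^ l)⁻¹) atTop (𝓝 1) := by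
    simpa using (tendsto_rootOfUnity.pow l).inv₀ (by simp)
  have hq := ((hinv.mul (tendsto_qInt l)).neg.pow k)
  have h := (hinv.pow (k - 1)).div hq
    (pow_ne_zero _ (by simpa using show l ≠ 0 by omega))
  refine ⟨_, h.congr' ?_⟩
  filter_upwards [eventually_ge_atTop l] with n hn
  rw [weight, qInt_rootOfUnity_sub hn, mul_comm (k - 1), pow_mul, rootOfUnity_pow_sub hn]
  rfl

/-- This is `1/(1 - w) + 1/(1 - w⁻¹) = 1` at `w = q^m`. -/
theorem inv_qInt_add_inv_qInt_sub {n m : ℕ} (hm : 0 < m) (hmn : m < n) :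
    (qInt (rootOfUnity n) m)⁻¹ + (qInt (rootOfUnity n) (n - m))⁻¹ = 1 - rootOfUnity n := by
  have h1 : 1 - rootOfUnity n ^ m ≠ 0 :=
    sub_ne_zero.2 ((isPrimitiveRoot_rootOfUnity (by omega)).pow_ne_one_of_pos_of_lt
      (by omega) hmn).symm
  have h2 : rootOfUnity n ^ m ≠ 0 := pow_ne_zero _ (rootOfUnity_ne_zero n)
  rw [qInt_rootOfUnity_sub hmn.le, qInt, inv_neg, mul_inv, inv_inv, inv_div]
  field_simp
  ring

/-- Adding the sum to its reflection makes each pair of terms equal to `1 - q`. -/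
theorem sum_weight_one (n : ℕ) : ∑ m ∈ Finset.range (n + 1), weight (rootOfUnity (n + 1)) 1 m =
    n * (1 - rootOfUnity (n + 1)) / 2 := by
  rw [Finset.sum_range_succ', weight_zero _ le_rfl, add_zero, eq_div_iff two_ne_zero, mul_two]
  nth_rw 1 [← Finset.sum_range_reflect]
  rw [← Finset.sum_add_distrib, Finset.sum_congr rfl fun m hm => ?_, Finset.sum_const,
    Finset.card_range, nsmul_eq_mul]
  have := Finset.mem_range.1 hm
  rw [weight_one, weight_one, ← inv_qInt_add_inv_qInt_sub (Nat.succ_pos m) (by omega), add_comm,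
    show n - 1 - m + 1 = n + 1 - (m + 1) by omega]

theorem tendsto_mul_one_sub_rootOfUnity :
    Tendsto (fun n : ℕ => (n : ℂ) * (1 - rootOfUnity n)) atTop
      (𝓝 (-2 * Real.pi * Complex.I)) := by
  have hd : HasDerivAt (fun t : ℂ => Complex.exp (2 * Real.pi * Complex.I * t))
      (2 * Real.pi * Complex.I) 0 := by
    simpa using ((hasDerivAt_id (0 : ℂ)).const_mul (2 * Real.pi * Complex.I)).cexp
  have hn : Tendsto (fun n : ℕ => (n : ℂ)⁻¹) atTop (𝓝[≠] 0) := by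
    refine tendsto_nhdsWithin_iff.2 ⟨tendsto_inv_atTop_nhds_zero_nat, ?_⟩
    filter_upwards [eventually_gt_atTop 0] with n hn
    simpa using hn.ne'
  refine ((hd.tendsto_slope_zero.comp hn).neg.congr fun n => ?_).trans_eq (by ring_nf)
  simp [rootOfUnity, div_eq_mul_inv]
  ring

theorem norm_sum_weight_one_le (n : ℕ) :
    ‖∑ m ∈ Finset.range n, weight (rootOfUnity n) 1 m‖ ≤ 4 := by
  cases n with
  | zero => simp
  | succ n =>
    rw [sum_weight_one, norm_div, norm_mul, Complex.norm_natCast, Complex.norm_ofNat,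
      div_le_iff₀ two_pos]
    calc (n : ℝ) * ‖1 - rootOfUnity (n + 1)‖ ≤ n * (2 * Real.pi / (n + 1 : ℕ)) := by
          gcongr
          exact norm_one_sub_rootOfUnity_le (n + 1)
      _ = 2 * Real.pi * (n / (n + 1 : ℕ)) := by ring
      _ ≤ 2 * Real.pi * 1 := by
          gcongr
          rw [div_le_one (by positivity)]
          push_cast
          linarith
      _ ≤ 4 * 2 := by linarith [Real.pi_le_four]

theorem exists_tendsto_sum_weight_one :
    ∃ a, Tendsto (fun n => ∑ m ∈ Finset.range n, weight (rootOfUnity n) 1 m) atTop (𝓝 a) := by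
  have h1 : Tendsto (fun n : ℕ => 1 - rootOfUnity n) atTop (𝓝 0) := by
    simpa using tendsto_rootOfUnity.const_sub 1
  refine ⟨_, ((tendsto_mul_one_sub_rootOfUnity.sub h1).div_const 2).congr' ?_⟩
  filter_upwards [eventually_gt_atTop 0] with n hn
  obtain ⟨n, rfl⟩ := Nat.exists_eq_succ_of_ne_zero hn.ne'
  rw [Nat.succ_eq_add_one, sum_weight_one]
  push_cast
  ring

theorem tendsto_choose_mul_one_sub_rootOfUnity_pow (i : ℕ) :
    Tendsto (fun n : ℕ => (n.choose i : ℂ) * (1 - rootOfUnity n) ^ i) atTop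
      (𝓝 ((-2 * Real.pi * Complex.I) ^ i / i.factorial)) := by
  have h1 : Tendsto (fun n : ℕ => (n.choose i : ℝ) * ((n : ℝ)⁻¹) ^ i) atTop
      (𝓝 (1 ^ i / i.factorial)) := by
    -- The Poisson limit for success probability `1/n`, whose rate is 1.
    refine ProbabilityTheory.tendsto_choose_mul_pow_atTop i (tendsto_const_nhds.congr' ?_)
    filter_upwards [eventually_gt_atTop 0] with n hn
    have : (n : ℝ) ≠ 0 := by exact_mod_cast hn.ne'
    field_simp
  have h2 := ((Complex.continuous_ofReal.tendsto _).comp h1).mul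
    (tendsto_mul_one_sub_rootOfUnity.pow i)
  have h3 : ((1 ^ i / i.factorial : ℝ) : ℂ) * (-2 * Real.pi * Complex.I) ^ i =
      (-2 * Real.pi * Complex.I) ^ i / i.factorial := by
    push_cast
    ring
  rw [h3] at h2
  refine h2.congr' ?_
  filter_upwards [eventually_gt_atTop 0] with n hn
  have : (n : ℂ) ≠ 0 := by exact_mod_cast hn.ne'
  simp only [Function.comp_apply]
  push_cast
  rw [mul_pow, inv_pow]
  field_simp

/-! ### Nested sums as operator products; existence of the limits -/

/-- The operator on `ℂ ^ (r + 1)` whose `i`-th coordinate is the coordinate `i + 1` of the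
argument and whose other coordinates vanish. -/
noncomputable def shiftAt (r : ℕ) (i : Fin r) : (Fin (r + 1) → ℂ) →L[ℂ] (Fin (r + 1) → ℂ) :=
  (ContinuousLinearMap.single ℂ (fun _ => ℂ) i.castSucc).comp (ContinuousLinearMap.proj i.succ)

theorem sum_smul_shiftAt_castSucc {r : ℕ} (c : Fin r → ℂ) (v : Fin (r + 1) → ℂ) (i : Fin r) :
    (∑ j, c j • shiftAt r j) v i.castSucc = c i * v i.succ := by
  simp [shiftAt, Pi.single_apply]

theorem sum_smul_shiftAt_last {r : ℕ} (c : Fin r → ℂ) (v : Fin (r + 1) → ℂ) :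
    (∑ j, c j • shiftAt r j) v (Fin.last r) = 0 := by
  simp [shiftAt, (Fin.castSucc_lt_last _).ne']

/-- Nested sums are coordinates of ordered products of operators. The scaling by `ε` makes
the operators small. -/
theorem descProd_apply_single {w : ℕ → ℕ → ℂ} (hw : ∀ j, w j 0 = 0) {ε : ℂ} (hε : ε ≠ 0)
    (r n : ℕ) (i : Fin (r + 1)) :
    descProd (fun m => 1 + ∑ j : Fin r, (ε * w j m) • shiftAt r j) n
      (Pi.single (Fin.last r) (ε⁻¹ ^ r)) i =
      ε⁻¹ ^ (i : ℕ) * nestedSum (fun j => w (i + j)) (r - i) n := by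
  induction n generalizing i with
  | zero =>
    refine Fin.lastCases ?_ (fun i => ?_) i
    · simp [descProd, nestedSum_zero_left]
    · obtain ⟨d, hd⟩ : ∃ d, r - (i : ℕ) = d + 1 := ⟨r - i - 1, by omega⟩
      simp [descProd, hd, nestedSum_succ_zero, (Fin.castSucc_lt_last i).ne]
  | succ n ih =>
    rw [descProd, mul_apply_eq_comp, add_apply, Pi.add_apply,
      one_apply_eq_self]
    revert i
    refine fun i => Fin.lastCases ?_ (fun i => ?_) i
    · rw [sum_smul_shiftAt_last, ih]
      simp [nestedSum_zero_left]
    -- The new factor adds `ε w_i(n)` times coordinate `i + 1`, which is the nested-sum recursion.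
    -- The `ε` turns `ε⁻¹ ^ (i + 1)` into `ε⁻¹ ^ i`.
    · obtain ⟨d, hd⟩ : ∃ d, r - (i : ℕ) = d + 1 := ⟨r - i - 1, by omega⟩
      rw [sum_smul_shiftAt_castSucc, ih, ih, Fin.val_castSucc, Fin.val_succ, hd,
        show r - (i + 1) = d by omega, nestedSum_succ_succ (fun j => w (i + j)) _ _ (hw _),
        pow_succ]
      simp only [add_zero, add_assoc, add_comm 1]
      field_simp

theorem exists_tendsto_nestedSum_weight {K : ℕ → ℕ} (hK : ∀ j, 1 ≤ K j) (r : ℕ) :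
    ∃ a, Tendsto (fun n => nestedSum (fun j m => weight (rootOfUnity n) (K j) m) r n) atTop
      (𝓝 a) := by
  set T := shiftAt r
  set S := ∑ j, ‖T j‖
  have hS : 0 ≤ S := Finset.sum_nonneg fun _ _ => norm_nonneg _
  -- This scaling forces `‖E‖ ≤ 1/8`. Below, `E` collects the positions with entry 1, which share
  -- one scalar weight, and `F` the summable rest.
  set ε : ℝ := 1 / (8 * (1 + S)) with hεdef
  have hε : 0 < ε := by positivity
  set E := ∑ j : Fin r, (ε * if K j = 1 then 1 else 0 : ℂ) • T j
  set F : ℕ → ℕ → (Fin (r + 1) → ℂ) →L[ℂ] (Fin (r + 1) → ℂ) := fun n m =>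
    ∑ j : Fin r, (ε * if K j = 1 then 0 else weight (rootOfUnity n) (K j) m : ℂ) • T j
  set C := ∑ j : Fin r, ε * 2 ^ K j * ‖T j‖
  have hE : ‖E‖ ≤ 1 / 8 := by
    calc ‖E‖ ≤ ∑ j, ε * ‖T j‖ := norm_sum_le_of_le _ fun j _ => by
          rw [norm_smul, norm_mul, Complex.norm_real, Real.norm_of_nonneg hε.le]
          gcongr
          split_ifs <;> simp [hε.le]
      _ = S / (8 * (1 + S)) := by rw [← Finset.mul_sum, hεdef]; ring
      _ ≤ 1 / 8 := by
          rw [div_le_div_iff₀ (by positivity) (by norm_num)]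
          linarith
  have hF : ∀ n m l : ℕ, 0 < l → ‖(qInt (rootOfUnity n) m)⁻¹‖ ≤ 2 / (l : ℝ) →
      ‖F n m‖ ≤ C / (l : ℝ) ^ 2 := fun n m l hl h => by
    rw [Finset.sum_div]
    refine norm_sum_le_of_le _ fun j _ => ?_
    rw [norm_smul, norm_mul, Complex.norm_real, Real.norm_of_nonneg hε.le]
    have : ‖(if K j = 1 then 0 else weight (rootOfUnity n) (K j) m : ℂ)‖ ≤
        2 ^ K j / (l : ℝ) ^ 2 := by
      split_ifs with h1
      · rw [norm_zero]; positivity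
      · exact norm_weight_le ((hK j).lt_of_ne' h1) hl h
    calc _ ≤ ε * (2 ^ K j / (l : ℝ) ^ 2) * ‖T j‖ := by gcongr
      _ = _ := by ring
  have hFt : ∀ f : ℕ → ℕ,
      (∀ j : Fin r, ∃ a, Tendsto (fun n => weight (rootOfUnity n) (K j) (f n)) atTop (𝓝 a)) →
      ∃ a, Tendsto (fun n => F n (f n)) atTop (𝓝 a) := fun f hf => by
    choose g hg using hf
    refine ⟨∑ j : Fin r, (ε * if K j = 1 then 0 else g j : ℂ) • T j,
      tendsto_finsetSum _ fun j _ => ((Tendsto.const_mul _ ?_).smul_const _)⟩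
    split_ifs
    · exact tendsto_const_nhds
    · exact hg j
  obtain ⟨a, ha⟩ := exists_tendsto_descProd_add E hE (fun n m => weight (rootOfUnity n) 1 m) F C
    (by positivity) (fun n => weight_zero _ le_rfl)
    (fun n => Finset.sum_eq_zero fun j _ => by
      rw [weight_zero _ (hK j), ite_self, mul_zero]
      exact zero_smul ℂ (T j))
    (fun n m hm hmn => by rw [weight_one]; exact norm_inv_qInt_le hm hmn)
    (fun n l hl hln => by rw [weight_one]; exact norm_inv_qInt_sub_le hl hln)
    (fun n m hm hmn => hF n m m hm (norm_inv_qInt_le hm hmn))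
    (fun n l hl hln => hF n (n - l) l hl (norm_inv_qInt_sub_le hl hln))
    (exists_tendsto_weight le_rfl) (fun l hl => exists_tendsto_weight_sub 1 hl)
    (fun m => hFt _ fun j => exists_tendsto_weight (hK j) m)
    (fun l hl => hFt _ fun j => exists_tendsto_weight_sub (K j) hl)
    exists_tendsto_sum_weight_one norm_sum_weight_one_le
  have hε' : (ε : ℂ) ≠ 0 := by exact_mod_cast hε.ne'
  have hev := (((ContinuousLinearMap.apply ℂ (Fin (r + 1) → ℂ)
    (Pi.single (Fin.last r) ((ε : ℂ)⁻¹ ^ r))).continuous.tendsto a).comp ha)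
  refine ⟨_, (((continuous_apply (0 : Fin (r + 1))).tendsto _).comp hev).congr fun n => ?_⟩
  have h := descProd_apply_single (w := fun j m => weight (rootOfUnity n) (K j) m)
    (fun j => weight_zero _ (hK j)) hε' r n 0
  simp only [Fin.val_zero, pow_zero, one_mul, zero_add, Nat.sub_zero] at h
  have hstep : (fun m => 1 + weight (rootOfUnity n) 1 m • E + F n m) =
      fun m => 1 + ∑ j : Fin r, (ε * weight (rootOfUnity n) (K j) m) • T j := by
    funext m
    rw [add_assoc, Finset.smul_sum, ← Finset.sum_add_distrib]
    congr 1
    refine Finset.sum_congr rfl fun j _ => ?_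
    rw [smul_smul]
    refine (add_smul (_ : ℂ) _ (T j)).symm.trans (congrArg (· • T j) ?_)
    split_ifs with h1
    · rw [h1]; ring
    · ring
  rw [← h, Function.comp_apply, Function.comp_apply, ContinuousLinearMap.apply_apply, hstep]

theorem tendsto_zSeq {r : ℕ} {K : Fin r → ℕ} (hK : ∀ i, 1 ≤ K i) :
    Tendsto (zSeq K) atTop (𝓝 (xi K)) := by
  refine tendsto_nhds_limUnder ?_
  obtain ⟨a, ha⟩ := exists_tendsto_nestedSum_weight
    -- The value 1 beyond the depth is a dummy that keeps all entries positive.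
    (K := fun j => if h : j < r then K ⟨j, h⟩ else 1)
    (fun j => by split_ifs; exacts [hK _, le_rfl]) r
  refine ⟨a, ha.congr fun n => ?_⟩
  simp [nestedSum, zSeq, z, weight, rootOfUnity]

/-! ### Generating functions at finite `n` -/

section GeneratingFunction

/-- The generating function `∑_{k ≥ 1} q ^ ((k - 1) m) / [m]_q ^ k X ^ k`. -/
noncomputable def weightSeries (q : ℂ) (m : ℕ) : PowerSeries ℂ :=
  PowerSeries.mk fun k => if k = 0 then 0 else weight q k m

theorem weightSeries_zero (q : ℂ) : weightSeries q 0 = 0 := by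
  ext k
  rw [weightSeries, PowerSeries.coeff_mk, map_zero]
  split_ifs with h
  · rfl
  · exact weight_zero q (Nat.one_le_iff_ne_zero.2 h)

/-- The zero constant term of `weightSeries` discards exactly the exponent tuples with a zero entry.
-/
theorem coeff_prod_weightSeries (q : ℂ) {r : ℕ} (m : Fin r → ℕ) (k : ℕ) :
    PowerSeries.coeff k (∏ i, weightSeries q (m i)) =
      ∑ K ∈ indexSet k r, ∏ i, weight q (K i) (m i) := by
  rw [PowerSeries.coeff_prod]
  have h1 : ∑ K ∈ indexSet k r, ∏ i, weight q (K i) (m i) =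
      ∑ K ∈ indexSet k r, ∏ i, PowerSeries.coeff (K i) (weightSeries q (m i)) := by
    refine Finset.sum_congr rfl fun K hK => Finset.prod_congr rfl fun i _ => ?_
    have := ((mem_indexSet K).1 hK).1 i
    rw [weightSeries, PowerSeries.coeff_mk, if_neg (by omega)]
  have h2 : ∑ K ∈ indexSet k r, ∏ i, PowerSeries.coeff (K i) (weightSeries q (m i)) =
      ∑ K ∈ Finset.Nat.antidiagonalTuple r k,
        ∏ i, PowerSeries.coeff (K i) (weightSeries q (m i)) := by
    refine Finset.sum_subset (Finset.filter_subset _ _) fun K hK hK' => ?_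
    simp only [indexSet, Finset.mem_filter, hK, true_and, not_forall] at hK'
    obtain ⟨i, hi⟩ := hK'
    refine Finset.prod_eq_zero (Finset.mem_univ i) ?_
    rw [weightSeries, PowerSeries.coeff_mk, if_pos (by omega)]
  rw [h1, h2]
  refine Finset.sum_bij' (fun l _ => ⇑l) (fun K _ => Finsupp.equivFunOnFinite.symm K)
    ?_ ?_ ?_ ?_ ?_
  · intro l hl
    rw [Finset.mem_finsuppAntidiag] at hl
    rw [Finset.Nat.mem_antidiagonalTuple]
    exact hl.1
  · intro K hK
    rw [Finset.Nat.mem_antidiagonalTuple] at hK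
    rw [Finset.mem_finsuppAntidiag]
    exact ⟨hK, Finset.subset_univ _⟩
  · intro l _; ext; rfl
  · intro K _; rfl
  · intro l _; rfl

theorem sum_z_eq_coeff (q : ℂ) (n k r : ℕ) :
    ∑ K ∈ indexSet k r, z n K q =
      PowerSeries.coeff k (nestedSum (fun _ m => weightSeries q m) r n) := by
  simp only [z, nestedSum, map_sum, coeff_prod_weightSeries]
  exact Finset.sum_comm

open Polynomial in
theorem coeff_prod_one_add_C_mul_X {R : Type*} [CommSemiring R] {w : ℕ → R} (hw : w 0 = 0)
    (n r : ℕ) :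
    (∏ m ∈ Finset.range n, (1 + C (w m) * X)).coeff r = nestedSum (fun _ => w) r n := by
  induction n generalizing r with
  | zero =>
    cases r with
    | zero => simp [nestedSum_zero_left]
    | succ r => simp [nestedSum_succ_zero, coeff_one]
  | succ n ih =>
    rw [Finset.prod_range_succ, mul_add, mul_one, coeff_add, ih, ← mul_assoc]
    cases r with
    | zero => simp [nestedSum_zero_left]
    | succ r =>
      rw [coeff_mul_X, mul_comm, coeff_C_mul, ih, nestedSum_succ_succ _ _ _ hw]

theorem prod_range_sub_pow_mul {R : Type*} [CommRing R] [IsDomain R] {ζ : R} {n : ℕ}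
    (hn : 0 < n) (hζ : IsPrimitiveRoot ζ n) (a b : R) :
    ∏ m ∈ Finset.range n, (a - ζ ^ m * b) = a ^ n - b ^ n := by
  classical
  have : NeZero n := ⟨hn.ne'⟩
  rw [hζ.pow_sub_pow_eq_prod_sub_mul a b hn]
  refine Finset.prod_bij (fun m _ => ζ ^ m) (fun m _ => ?_) (fun i hi j hj h => ?_)
    (fun μ hμ => ?_) fun _ _ => rfl
  · rw [Polynomial.mem_nthRootsFinset hn, ← pow_mul, mul_comm, pow_mul, hζ.pow_eq_one, one_pow]
  · exact hζ.pow_inj (Finset.mem_range.1 hi) (Finset.mem_range.1 hj) h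
  · obtain ⟨i, hi, h⟩ := hζ.eq_pow_of_pow_eq_one ((Polynomial.mem_nthRootsFinset hn _).1 hμ)
    exact ⟨i, Finset.mem_range.2 hi, h⟩

/-- The geometric series of ratio `q^m X / [m]_q`, cleared of denominators. -/
theorem sub_mul_weightSeries {q : ℂ} (hq : q ≠ 1) {m : ℕ} (hm : q ^ m ≠ 1) :
    (1 - PowerSeries.C (q ^ m) * (1 + PowerSeries.C (1 - q) * PowerSeries.X)) *
      weightSeries q m = PowerSeries.C (1 - q) * PowerSeries.X := by
  have h1 : 1 - q ≠ 0 := sub_ne_zero.2 hq.symm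
  have h2 : 1 - q ^ m ≠ 0 := sub_ne_zero.2 hm.symm
  have h3 : (1 - PowerSeries.C (q ^ m) * (1 + PowerSeries.C (1 - q) * PowerSeries.X)) *
      weightSeries q m = PowerSeries.C (1 - q ^ m) * weightSeries q m -
        PowerSeries.C (q ^ m * (1 - q)) * (PowerSeries.X * weightSeries q m) := by
    simp only [map_sub, map_mul, map_one]
    ring
  rw [h3]
  ext k
  rw [map_sub, PowerSeries.coeff_C_mul, PowerSeries.coeff_C_mul, PowerSeries.coeff_C_mul]
  rcases k with _ | _ | k
  · simp [weightSeries]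
  · rw [zero_add, PowerSeries.coeff_one_X, ← zero_add 1, PowerSeries.coeff_succ_X_mul]
    simp only [weightSeries, PowerSeries.coeff_mk, weight, qInt]
    simp
    field_simp
  · rw [PowerSeries.coeff_succ_X_mul, PowerSeries.coeff_X, if_neg (by omega)]
    simp only [weightSeries, PowerSeries.coeff_mk, weight, qInt]
    simp only [Nat.add_eq_zero_iff, one_ne_zero, and_false, if_false, Nat.add_sub_cancel, mul_zero]
    rw [add_mul k 1 m, pow_add, pow_succ ((1 - q ^ m) / (1 - q)) (k + 1)]
    field_simp
    ring

open Polynomial in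
-- With `Y` the polynomial variable, `1 + Y · weightSeries q m` is the quotient of `(1 + UY) - q^m
-- (1 + U)` by `1 - q^m (1 + U)`. Products over all `m < n` are differences of `n`-th powers, and
-- the surplus `m = 0` factors `U(Y - 1)` and `-U` account for `1 - Y`.
theorem generating_identity {q : ℂ} {n : ℕ} (hn : 2 ≤ n) (hq : IsPrimitiveRoot q n) :
    C ((1 + PowerSeries.C (1 - q) * PowerSeries.X) ^ n - 1) *
        (∏ m ∈ Finset.range n, (1 + C (weightSeries q m) * X)) * (1 - X) =
      C ((1 + PowerSeries.C (1 - q) * PowerSeries.X) ^ n) -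
        (1 + C (PowerSeries.C (1 - q) * PowerSeries.X) * X) ^ n := by
  obtain ⟨n, rfl⟩ := Nat.exists_eq_succ_of_ne_zero (show n ≠ 0 by omega)
  rw [Nat.succ_eq_add_one] at *
  set U : PowerSeries ℂ := PowerSeries.C (1 - q) * PowerSeries.X with hU
  have hζ : IsPrimitiveRoot (C (PowerSeries.C q)) (n + 1) :=
    (hq.map_of_injective PowerSeries.C_injective).map_of_injective C_injective
  have h1 := prod_range_sub_pow_mul (by omega) hζ 1 (C (1 + U))
  have h2 := prod_range_sub_pow_mul (by omega) hζ (1 + C U * X) (C (1 + U))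
  rw [Finset.prod_range_succ'] at h1 h2
  have h3 : (∏ m ∈ Finset.range n, (1 - C (PowerSeries.C q) ^ (m + 1) * C (1 + U))) *
      ∏ m ∈ Finset.range n, (1 + C (weightSeries q (m + 1)) * X) =
      ∏ m ∈ Finset.range n, (1 + C U * X - C (PowerSeries.C q) ^ (m + 1) * C (1 + U)) := by
    rw [← Finset.prod_mul_distrib]
    refine Finset.prod_congr rfl fun m hm => ?_
    have hm' := Finset.mem_range.1 hm
    have h := congrArg C (sub_mul_weightSeries (hq.ne_one (by omega))
      (hq.pow_ne_one_of_pos_of_lt (show m + 1 ≠ 0 by omega) (by omega)))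
    rw [← hU] at h
    simp only [map_mul, map_sub, map_one, map_pow] at h ⊢
    linear_combination X * h
  rw [Finset.prod_range_succ', weightSeries_zero]
  simp only [pow_zero, one_mul, map_zero, zero_mul, add_zero, mul_one, map_sub, map_pow,
    map_add, map_one, one_pow] at h1 h2 h3 ⊢
  linear_combination (1 - X) * (∏ m ∈ Finset.range n, (1 + C (weightSeries q (m + 1)) * X)) * h1 -
    h2 + C U * (1 - X) * h3

open Polynomial in
-- The factor `1 - Y` turns coefficients in `Y` into consecutive differences, so induction on `r`
-- sums the binomial terms.
theorem mul_nestedSum_weightSeries {q : ℂ} {n : ℕ} (hn : 2 ≤ n) (hq : IsPrimitiveRoot q n)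
    (r : ℕ) :
    ((1 + PowerSeries.C (1 - q) * PowerSeries.X) ^ n - 1) *
        nestedSum (fun _ m => weightSeries q m) r n =
      (1 + PowerSeries.C (1 - q) * PowerSeries.X) ^ n - 1 -
        ∑ j ∈ Finset.Icc 1 r,
          PowerSeries.C ((n.choose j : ℂ) * (1 - q) ^ j) * PowerSeries.X ^ j := by
  induction r with
  | zero => simp [nestedSum_zero_left]
  | succ r ih =>
    have h := congrArg (coeff · (r + 1)) (generating_identity hn hq)
    simp only [mul_sub, mul_one, mul_assoc, coeff_sub, coeff_C_mul, coeff_mul_X,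
      coeff_prod_one_add_C_mul_X (weightSeries_zero q), coeff_C_succ] at h
    have h2 : ((1 + C (PowerSeries.C (1 - q) * PowerSeries.X) * X : (PowerSeries ℂ)[X]) ^ n).coeff
        (r + 1) = PowerSeries.C ((n.choose (r + 1) : ℂ) * (1 - q) ^ (r + 1)) *
          PowerSeries.X ^ (r + 1) := by
      have : ((1 + C (PowerSeries.C (1 - q) * PowerSeries.X) * X : (PowerSeries ℂ)[X]) ^ n) =
          ((1 + X) ^ n).comp (C (PowerSeries.C (1 - q) * PowerSeries.X) * X) := by simp
      rw [this, comp_C_mul_X_coeff, coeff_one_add_X_pow]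
      simp only [map_mul, map_pow, map_natCast]
      ring
    rw [h2] at h
    rw [Finset.sum_Icc_succ_top (by omega), ← sub_sub, ← ih]
    linear_combination h

theorem coeff_one_add_C_mul_X_pow (a : ℂ) (n i : ℕ) :
    PowerSeries.coeff i ((1 + PowerSeries.C a * PowerSeries.X) ^ n) = n.choose i * a ^ i := by
  have h : ((1 + Polynomial.C a * Polynomial.X : Polynomial ℂ) ^ n) =
      ((1 + Polynomial.X) ^ n).comp (Polynomial.C a * Polynomial.X) := by simp
  have h2 : (1 + PowerSeries.C a * PowerSeries.X) ^ n =
      (((1 + Polynomial.C a * Polynomial.X : Polynomial ℂ) ^ n : Polynomial ℂ) :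
        PowerSeries ℂ) := by simp
  rw [h2, Polynomial.coeff_coe, h, Polynomial.comp_C_mul_X_coeff, Polynomial.coeff_one_add_X_pow]

end GeneratingFunction

/-! ### Passage to the limit and Bernoulli numbers -/

/-- The generating function `∑ ξ(K) X ^ |K|` over all indices `K` of depth `r`. -/
noncomputable def xiSeries (r : ℕ) : PowerSeries ℂ :=
  PowerSeries.mk fun k => ∑ K ∈ indexSet k r, xi K

theorem exp_sub_one_mul_xiSeries (r : ℕ) :
    (PowerSeries.rescale (-2 * Real.pi * Complex.I) (PowerSeries.exp ℂ) - 1) * xiSeries r =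
      PowerSeries.rescale (-2 * Real.pi * Complex.I) (PowerSeries.exp ℂ) - 1 -
        ∑ j ∈ Finset.Icc 1 r,
          PowerSeries.C ((-2 * Real.pi * Complex.I) ^ j / j.factorial) * PowerSeries.X ^ j := by
  set τ : ℂ := -2 * Real.pi * Complex.I
  have hA : ∀ i, Tendsto (fun n => PowerSeries.coeff i
      ((1 + PowerSeries.C (1 - rootOfUnity n) * PowerSeries.X) ^ n - 1)) atTop
      (𝓝 (PowerSeries.coeff i (PowerSeries.rescale τ (PowerSeries.exp ℂ) - 1))) := fun i => by
    have h : ∀ n, PowerSeries.coeff i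
        ((1 + PowerSeries.C (1 - rootOfUnity n) * PowerSeries.X) ^ n - 1) =
        n.choose i * (1 - rootOfUnity n) ^ i - PowerSeries.coeff i 1 := fun n => by
      rw [map_sub, coeff_one_add_C_mul_X_pow]
    have h' : PowerSeries.coeff i (PowerSeries.rescale τ (PowerSeries.exp ℂ) - 1) =
        τ ^ i / i.factorial - PowerSeries.coeff i 1 := by
      rw [map_sub, PowerSeries.coeff_rescale, PowerSeries.coeff_exp, eq_ratCast]
      push_cast
      ring
    simp only [h, h']
    exact (tendsto_choose_mul_one_sub_rootOfUnity_pow i).sub_const _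
  have hS : ∀ k, Tendsto (fun n => PowerSeries.coeff k
      (nestedSum (fun _ m => weightSeries (rootOfUnity n) m) r n)) atTop
      (𝓝 (PowerSeries.coeff k (xiSeries r))) := fun k => by
    rw [xiSeries, PowerSeries.coeff_mk]
    simp only [← sum_z_eq_coeff]
    exact tendsto_finsetSum _ fun K hK => tendsto_zSeq ((mem_indexSet K).1 hK).1
  ext N
  -- Each coefficient of the product is a finite sum, so limits may be taken coefficientwise.
  have hL := tendsto_finsetSum (Finset.HasAntidiagonal.antidiagonal N) fun p _ => (hA p.1).mul (hS p.2)
  have hR := (hA N).sub (tendsto_finsetSum (Finset.Icc 1 r) fun j _ =>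
    (tendsto_choose_mul_one_sub_rootOfUnity_pow j).mul_const
      (PowerSeries.coeff N (PowerSeries.X ^ j)))
  rw [PowerSeries.coeff_mul]
  refine (tendsto_nhds_unique_of_eventuallyEq hL hR ?_).trans ?_
  · filter_upwards [eventually_ge_atTop 2] with n hn
    have h := mul_nestedSum_weightSeries hn (isPrimitiveRoot_rootOfUnity (by omega)) r
    have h' := congrArg (PowerSeries.coeff N) h
    rw [PowerSeries.coeff_mul] at h'
    rw [h', map_sub, map_sum]
    simp only [PowerSeries.coeff_C_mul]
  · rw [map_sub _ (_ - _) (∑ j ∈ _, _), map_sum]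
    simp only [PowerSeries.coeff_C_mul, τ]

theorem sum_xi {k r : ℕ} (hr : 1 ≤ r) (hrk : r ≤ k) :
    ∑ K ∈ indexSet k r, xi K =
      -((-2 * (Real.pi : ℂ) * Complex.I) ^ k / ((k + 1).factorial : ℂ)) *
        ∑ j ∈ Finset.Icc 1 r, ((k + 1).choose j : ℂ) * ((bernoulli (k + 1 - j) : ℚ) : ℂ) := by
  have h1 := exp_sub_one_mul_xiSeries r
  set τ : ℂ := -2 * Real.pi * Complex.I
  have hτ : τ ≠ 0 := by simp [τ, Real.pi_ne_zero]
  have h2 := congrArg (PowerSeries.rescale τ) (bernoulliPowerSeries_mul_exp_sub_one ℂ)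
  rw [map_mul, map_sub, map_one, PowerSeries.rescale_X] at h2
  -- Multiply by the rescaled Bernoulli series, whose product with `e^(τX) - 1` is `τX`.
  have h3 : PowerSeries.C τ * (PowerSeries.X * xiSeries r) =
      PowerSeries.C τ * PowerSeries.X - ∑ j ∈ Finset.Icc 1 r,
        PowerSeries.C (τ ^ j / j.factorial) * (PowerSeries.X ^ j *
          PowerSeries.rescale τ (bernoulliPowerSeries ℂ)) := by
    simp only [← mul_assoc, ← Finset.sum_mul]
    linear_combination PowerSeries.rescale τ (bernoulliPowerSeries ℂ) * h1 +
      (1 - xiSeries r) * h2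
  -- The factor `X` on the left shifts the degree to `k + 1`. The term `τX` does not contribute
  -- because `k ≥ 1`.
  have h4 := congrArg (PowerSeries.coeff (k + 1)) h3
  rw [map_sub, map_sum, PowerSeries.coeff_C_mul, PowerSeries.coeff_succ_X_mul,
    PowerSeries.coeff_C_mul, PowerSeries.coeff_X, if_neg (by omega), mul_zero, zero_sub,
    xiSeries, PowerSeries.coeff_mk] at h4
  refine mul_left_cancel₀ hτ (h4.trans ?_)
  rw [neg_mul, mul_neg, Finset.mul_sum, Finset.mul_sum]
  congr 1
  refine Finset.sum_congr rfl fun j hj => ?_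
  have hj' := (Finset.mem_Icc.1 hj).2
  rw [PowerSeries.coeff_C_mul, PowerSeries.coeff_X_pow_mul', if_pos (by omega),
    PowerSeries.coeff_rescale, bernoulliPowerSeries, PowerSeries.coeff_mk,
    Nat.cast_choose ℂ (show j ≤ k + 1 by omega)]
  obtain ⟨d, hd⟩ : ∃ d, k + 1 = j + d := ⟨k + 1 - j, by omega⟩
  have hf : ((k + 1).factorial : ℂ) ≠ 0 := by exact_mod_cast (k + 1).factorial_ne_zero
  have hτk : τ * τ ^ k = τ ^ j * τ ^ d := by rw [← pow_add, ← hd, pow_succ']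
  rw [show k + 1 - j = d by omega]
  simp only [eq_ratCast, Rat.cast_div, Rat.cast_natCast]
  rw [mul_div_assoc', ← mul_assoc, mul_div_assoc' τ, hτk]
  have hfj : (j.factorial : ℂ) ≠ 0 := by exact_mod_cast j.factorial_ne_zero
  have hfd : (d.factorial : ℂ) ≠ 0 := by exact_mod_cast d.factorial_ne_zero
  field_simp

end FiniteMHS

theorem corollary1p3 (k r : ℕ) (hr : 1 ≤ r) (hrk : r ≤ k) :
    (∀ K ∈ FiniteMHS.indexSet k r,
      Filter.Tendsto (FiniteMHS.zSeq K) Filter.atTop (nhds (FiniteMHS.xi K))) ∧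
    ∑ K ∈ FiniteMHS.indexSet k r, FiniteMHS.xi K =
      -((-2 * (Real.pi : ℂ) * Complex.I) ^ k / ((k + 1).factorial : ℂ)) *
        ∑ j ∈ Finset.Icc 1 r, ((k + 1).choose j : ℂ) * ((bernoulli (k + 1 - j) : ℚ) : ℂ) :=
  ⟨fun K hK => FiniteMHS.tendsto_zSeq ((FiniteMHS.mem_indexSet K).1 hK).1,
    FiniteMHS.sum_xi hr hrk⟩
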